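/- Let $A_n$ be the transition matrix of the $1\times n$ $\Phi$ automaton (each cell's next state is the sum modulo $2$ of the states of its left and right neighbours), i.e. the $n\times n$ matrix over $GF(2)$ with $(A_n)_{ij}=1$ if $|i-j|=1$ and $(A_n)_{ij}=0$ otherwise. Let $T_n=A_n\otimes I_n+I_n\otimes A_n$ (the Kronecker sum $A_n\oplus A_n$), an $n^2\times n^2$ matrix over $GF(2)$; it is the transition matrix of the $n\times n$ $\sigma$ automaton, in which each cell's next state is the sum modulo $2$ of the states of its horizontal and vertical neighbours. For a square matrix $X$ over $GF(2)$, let the cycle length $CL(X)$ be the least integer $i\ge 1$ such that $X^{k}=X^{k+i}$ for some $k\ge 0$, and write $CL(\Phi_n)=CL(A_n)$ and $CL(\sigma_n)=CL(T_n)$. Then for every integer $n\ge 0$ with $n\ne 2$ and $n\ne 4$, $$CL(\Phi_n)=CL(\sigma_n).$$ In the exceptional cases, $CL(\Phi_2)=2$, $CL(\sigma_2)=1$, $CL(\Phi_4)=6$ and $CL(\sigma_4)=2$. -/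

import Mathlib

open scoped Kronecker

namespace LightsOut

/-- The transition matrix `A_n` over `GF(2)` of the `1 × n` automaton `Φ`: the state of a cell
becomes the sum modulo 2 of the states of the (at most two) cells adjacent to it. -/
def phiMatrix (n : ℕ) : Matrix (Fin n) (Fin n) (ZMod 2) :=
  Matrix.of fun i j => if (i : ℕ) + 1 = j ∨ (j : ℕ) + 1 = i then 1 else 0

/-- The Kronecker sum `M ⊕ N = M ⊗ I + I ⊗ N` of two square matrices over `GF(2)`. -/
def kroneckerSum {ι κ : Type*} [DecidableEq ι] [DecidableEq κ]
    (M : Matrix ι ι (ZMod 2)) (N : Matrix κ κ (ZMod 2)) : Matrix (ι × κ) (ι × κ) (ZMod 2) :=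
  M ⊗ₖ (1 : Matrix κ κ (ZMod 2)) + (1 : Matrix ι ι (ZMod 2)) ⊗ₖ N

/-- The transition matrix `T_n = A_n ⊕ A_n` over `GF(2)` of the `n × n` automaton `σ`; the cells of
the square grid are the pairs in `Fin n × Fin n`. -/
def sigmaMatrix (n : ℕ) : Matrix (Fin n × Fin n) (Fin n × Fin n) (ZMod 2) :=
  kroneckerSum (phiMatrix n) (phiMatrix n)

/-- The cycle length `CL(X)` of a square matrix over `GF(2)`: the least `i > 0` such that
`X ^ k = X ^ (k + i)` for some `k`, that is, the eventual period of the powers of `X`. -/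
noncomputable def cycleLength {ι : Type*} [Fintype ι] [DecidableEq ι]
    (X : Matrix ι ι (ZMod 2)) : ℕ :=
  sInf {i : ℕ | 0 < i ∧ ∃ k : ℕ, X ^ k = X ^ (k + i)}

/-- The minimum in the definition of the cycle length is always attained, since there are only
finitely many matrices of a given size over `GF(2)`. -/
theorem isLeast_cycleLength {ι : Type*} [Fintype ι] [DecidableEq ι]
    (X : Matrix ι ι (ZMod 2)) :
    IsLeast {i : ℕ | 0 < i ∧ ∃ k : ℕ, X ^ k = X ^ (k + i)} (cycleLength X) := by
  have hne : {i : ℕ | 0 < i ∧ ∃ k : ℕ, X ^ k = X ^ (k + i)}.Nonempty := by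
    have : Finite (Matrix ι ι (ZMod 2)) := inferInstanceAs (Finite (ι → ι → ZMod 2))
    obtain ⟨a, b, hab, h⟩ := Finite.exists_ne_map_eq_of_infinite (fun k : ℕ => X ^ k)
    rcases lt_or_gt_of_ne hab with hlt | hlt
    · exact ⟨b - a, Nat.sub_pos_of_lt hlt, a, by rw [Nat.add_sub_cancel' hlt.le]; exact h⟩
    · exact ⟨a - b, Nat.sub_pos_of_lt hlt, b, by rw [Nat.add_sub_cancel' hlt.le]; exact h.symm⟩
  exact ⟨Nat.sInf_mem hne, fun _ hi => Nat.sInf_le hi⟩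

end LightsOut

namespace LightsOut

open scoped Matrix

/-! Let `s ^ (2 * (n + 1)) = 1` in characteristic 2. The vector with entries `s^a + s⁻ᵃ`, `1 ≤ a ≤
n`, is an eigenvector of `A_n` with eigenvalue `w(s) = s + s⁻¹`, and tensor products of two such
vectors give eigenvalues `w(s) + w(t)` of `T_n`. For generic `s`, `t` in group algebras the entries
are independent, so a period of the eigenvalue is a period of the matrix. Write `n + 1 = 2^k m` with
`m` odd; if `m = 1` both matrices are nilpotent.

From `Φ` to `σ`: the identity `w(a) w(b) = w(ab) + w(a/b)` turns `w(s) + w(t)`, after a `2^(k+1)`-th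
power, into a product of eigenvalues of `A_n`. This costs nothing, because a nilpotent perturbation
of a root of unity shows that `2^(k+1)` divides every period of `A_n` when `m ≠ 1`
(`two_pow_dvd_of_eventuallyPeriodic`).

From `σ` to `Φ`: for odd `n`, `A_n` has a kernel vector, and tensoring with it embeds `A_n` in
`T_n`. For even `n ≥ 6` there are enough roots of unity to isolate each `w(z)^i` from products
`(w(a) w(b))^i = 1` (`addInv_pow_eq_one`); periods are again even, and a polynomial divisibility
lifts the result to the double roots of `X^(2(n+1)) - 1`. Only `n = 2` and `n = 4` have too few
roots. -/

/-- The powers of `x` eventually repeat with period `i`. -/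
def EventuallyPeriodic {M : Type*} [Monoid M] (x : M) (i : ℕ) : Prop :=
  ∃ k : ℕ, x ^ k = x ^ (k + i)

/-! ### Eventual periods in monoids. -/

namespace EventuallyPeriodic

variable {M : Type*}

theorem shift [Monoid M] {x : M} {k i : ℕ} (h : x ^ k = x ^ (k + i)) (l : ℕ) :
    x ^ (k + l) = x ^ (k + l + i) := by
  rw [pow_add, h, ← pow_add]
  congr 1
  omega

theorem mul [CommMonoid M] {x y : M} {i : ℕ} (hx : EventuallyPeriodic x i)
    (hy : EventuallyPeriodic y i) : EventuallyPeriodic (x * y) i := by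
  obtain ⟨k, hk⟩ := hx
  obtain ⟨l, hl⟩ := hy
  refine ⟨k + l, ?_⟩
  rw [mul_pow, mul_pow, shift hk l, add_comm k l, shift hl k]

theorem of_pow [Monoid M] {x : M} {q j : ℕ} (h : EventuallyPeriodic (x ^ q) j) :
    EventuallyPeriodic x (q * j) := by
  obtain ⟨k, hk⟩ := h
  exact ⟨q * k, by rw [← mul_add, pow_mul, pow_mul, hk]⟩

theorem pow [Monoid M] {x : M} {q j : ℕ} (hq : 0 < q) (h : EventuallyPeriodic x (q * j)) :
    EventuallyPeriodic (x ^ q) j := by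
  obtain ⟨k, hk⟩ := h
  obtain ⟨l, hl⟩ : ∃ l, q * k = k + l := ⟨q * k - k, by have := Nat.le_mul_of_pos_left k hq; omega⟩
  refine ⟨k, ?_⟩
  rw [← pow_mul, ← pow_mul, mul_add, hl, shift hk l]

theorem of_pow_eq_zero [MonoidWithZero M] {x : M} {q : ℕ} (h : x ^ q = 0) (i : ℕ) :
    EventuallyPeriodic x i :=
  ⟨q, by rw [pow_add, h, zero_mul]⟩

theorem pow_eq_one [Monoid M] {x : M} {i : ℕ} (hx : IsUnit x) (h : EventuallyPeriodic x i) :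
    x ^ i = 1 := by
  obtain ⟨k, hk⟩ := h
  rw [pow_add] at hk
  exact (hx.pow k).mul_left_cancel (by rw [← hk, mul_one])

end EventuallyPeriodic

theorem cycleLength_congr {ι κ : Type*} [Fintype ι] [DecidableEq ι] [Fintype κ] [DecidableEq κ]
    {X : Matrix ι ι (ZMod 2)} {Y : Matrix κ κ (ZMod 2)}
    (h : ∀ i, EventuallyPeriodic X i ↔ EventuallyPeriodic Y i) :
    cycleLength X = cycleLength Y := by
  unfold cycleLength
  congr 1
  ext i
  exact and_congr_right fun _ => h i

/-- The element `s + s⁻¹` attached to a unit `s`. -/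
def addInv {R : Type*} [CommRing R] (s : Rˣ) : R := (s : R) + ((s⁻¹ : Rˣ) : R)

/-! ### The function `s + s⁻¹` in characteristic 2. -/

section AddInv

variable {R : Type*} [CommRing R]

theorem addInv_mul (s t : Rˣ) :
    addInv s * addInv t = addInv (s * t) + addInv (s * t⁻¹) := by
  simp only [addInv, mul_inv, inv_inv, Units.val_mul]
  ring

variable [CharP R 2]

theorem addInv_eq_zero {s : Rˣ} (h : s ^ 2 = 1) : addInv s = 0 := by
  have : s⁻¹ = s := by rw [inv_eq_iff_mul_eq_one, ← sq, h]
  rw [addInv, this, CharTwo.add_self_eq_zero]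

theorem addInv_pow (s : Rˣ) (e : ℕ) : addInv s ^ 2 ^ e = addInv (s ^ 2 ^ e) := by
  have : ExpChar R 2 := ExpChar.prime Nat.prime_two
  rw [addInv, add_pow_expChar_pow, addInv, ← inv_pow, Units.val_pow_eq_pow_val,
    Units.val_pow_eq_pow_val]

theorem addInv_ne_zero {s : Rˣ} {m : ℕ} (hm : Odd m) (hs : s ^ m = 1) (h1 : s ≠ 1) :
    addInv s ≠ 0 := by
  intro h
  apply h1
  have h2 : s ^ 2 = 1 := by
    ext
    have : (s : R) * addInv s = 0 := by rw [h, mul_zero]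
    rw [addInv, mul_add, Units.mul_inv, ← sq] at this
    rw [Units.val_pow_eq_pow_val, Units.val_one]
    exact CharTwo.add_eq_zero.1 this
  have := (pow_gcd_eq_one (a := s)).2 ⟨h2, hs⟩
  rwa [(Nat.coprime_two_left.2 hm).gcd_eq_one, pow_one] at this

end AddInv

/-! ### Eigenvectors of `A_n` and `T_n` from roots of unity. -/

section Eigenvectors

variable {R : Type*} [CommRing R] {n : ℕ}

/-- The zeros of `g` at `0` and `n + 1` stand in for the missing neighbours of the two end cells. -/
theorem phiMatrix_map_mulVec (f : ZMod 2 →+* R) {g : ℕ → R} (h0 : g 0 = 0) (hn : g (n + 1) = 0) :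
    (phiMatrix n).map f *ᵥ (fun a : Fin n => g (a + 1)) = fun a : Fin n => g a + g (a + 2) := by
  ext ⟨a, ha⟩
  have h1 : ∀ b : ℕ, f (if a + 1 = b ∨ b + 1 = a then 1 else 0) * g (b + 1) =
      (if b + 1 = a then g (b + 1) else 0) + if b = a + 1 then g (b + 1) else 0 := by
    intro b
    by_cases h : a + 1 = b
    · have : ¬ (b + 1 = a) := by omega
      simp [h]
      omega
    · have : ¬ (b = a + 1) := fun h' => h h'.symm
      simp only [h, this, false_or, if_false, add_zero]
      split_ifs <;> simp
  have h2 : ∑ b ∈ Finset.range n, (if b + 1 = a then g (b + 1) else 0) = g a := by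
    have := Finset.sum_range_succ' (fun b => if b = a then g b else 0) n
    rw [Finset.sum_ite_eq' _ a, if_pos (Finset.mem_range.2 (by omega)), h0, ite_self, add_zero]
      at this
    exact this.symm
  have h3 : ∑ b ∈ Finset.range n, (if b = a + 1 then g (b + 1) else 0) = g (a + 2) := by
    have := Finset.sum_range_succ (fun b => if b = a + 1 then g (b + 1) else 0) n
    rw [Finset.sum_ite_eq' _ (a + 1), if_pos (Finset.mem_range.2 (by omega)), hn, ite_self,
      add_zero] at this
    exact this.symm
  simp only [Matrix.mulVec, dotProduct, Matrix.map_apply, phiMatrix, Matrix.of_apply]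
  rw [Fin.sum_univ_eq_sum_range (fun b => f (if a + 1 = b ∨ b + 1 = a then 1 else 0) * g (b + 1)) n,
    Finset.sum_congr rfl fun b _ => h1 b, Finset.sum_add_distrib, h2, h3]

/-- The condition on `s` makes `s ^ (n + 1)` its own inverse, so the right boundary value vanishes;
the rest is `addInv_mul`. -/
theorem phiMatrix_map_mulVec_addInv [CharP R 2] (f : ZMod 2 →+* R) {s : Rˣ}
    (hs : s ^ (2 * (n + 1)) = 1) :
    (phiMatrix n).map f *ᵥ (fun a : Fin n => addInv (s ^ (a + 1 : ℕ))) =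
      addInv s • fun a : Fin n => addInv (s ^ (a + 1 : ℕ)) := by
  rw [phiMatrix_map_mulVec f (g := fun j => addInv (s ^ j)) (addInv_eq_zero (by simp))
    (addInv_eq_zero (by rw [← pow_mul, mul_comm, hs]))]
  ext a
  rw [Pi.smul_apply, smul_eq_mul, mul_comm, addInv_mul, add_comm, ← pow_succ,
    pow_succ s (a : ℕ), mul_inv_cancel_right]

theorem sigmaMatrix_map_mulVec (f : ZMod 2 →+* R) (x y : Fin n → R) :
    (sigmaMatrix n).map f *ᵥ (fun p => x p.1 * y p.2) = fun p =>
      ((phiMatrix n).map f *ᵥ x) p.1 * y p.2 + x p.1 * ((phiMatrix n).map f *ᵥ y) p.2 := by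
  ext ⟨a, b⟩
  simp only [sigmaMatrix, kroneckerSum, Matrix.mulVec, dotProduct, Matrix.map_apply,
    Matrix.add_apply, Matrix.kroneckerMap_apply, map_add, map_mul, add_mul,
    Finset.sum_add_distrib, Fintype.sum_prod_type, Matrix.one_apply]
  congr 1
  · rw [Finset.sum_mul]
    refine Finset.sum_congr rfl fun i _ => ?_
    rw [Finset.sum_eq_single b] <;> simp +contextual [mul_assoc, eq_comm]
  · rw [Finset.sum_eq_single a]
    · simp only [if_true, map_one, one_mul, Finset.mul_sum]
      exact Finset.sum_congr rfl fun i _ => by ring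
    · intro i _ h
      simp [Ne.symm h]
    · simp

theorem sigmaMatrix_map_mulVec_addInv [CharP R 2] (f : ZMod 2 →+* R) {s t : Rˣ}
    (hs : s ^ (2 * (n + 1)) = 1) (ht : t ^ (2 * (n + 1)) = 1) :
    (sigmaMatrix n).map f *ᵥ
        (fun p => addInv (s ^ (p.1 + 1 : ℕ)) * addInv (t ^ (p.2 + 1 : ℕ))) =
      (addInv s + addInv t) •
        fun p => addInv (s ^ (p.1 + 1 : ℕ)) * addInv (t ^ (p.2 + 1 : ℕ)) := by
  rw [sigmaMatrix_map_mulVec f (fun a => addInv (s ^ (a + 1 : ℕ)))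
    (fun a => addInv (t ^ (a + 1 : ℕ))), phiMatrix_map_mulVec_addInv f hs,
    phiMatrix_map_mulVec_addInv f ht]
  ext p
  simp only [Pi.smul_apply, smul_eq_mul]
  ring

theorem pow_map_mulVec {ι : Type*} [Fintype ι] [DecidableEq ι] (f : ZMod 2 →+* R)
    {X : Matrix ι ι (ZMod 2)} {v : ι → R} {c : R} (h : X.map f *ᵥ v = c • v) (k : ℕ) :
    (X ^ k).map f *ᵥ v = c ^ k • v := by
  induction k with
  | zero => simp [Matrix.map_one]
  | succ k ih =>
    rw [pow_succ, Matrix.map_mul, ← Matrix.mulVec_mulVec, h, Matrix.mulVec_smul, ih, smul_smul,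
      pow_succ']

theorem EventuallyPeriodic.eigenvalue {ι : Type*} [Fintype ι] [DecidableEq ι] (f : ZMod 2 →+* R)
    {X : Matrix ι ι (ZMod 2)} {v : ι → R} {c : R} (h : X.map f *ᵥ v = c • v) {i : ℕ}
    (hX : EventuallyPeriodic X i) : ∃ k, ∀ a, c ^ k * v a = c ^ (k + i) * v a := by
  obtain ⟨k, hk⟩ := hX
  refine ⟨k, fun a => ?_⟩
  have := pow_map_mulVec f h k
  rw [hk, pow_map_mulVec f h] at this
  exact (congrFun this a).symm

variable [CharP R 2] {i : ℕ}

/-- The first coordinate of the eigenvector is the eigenvalue itself, so it is absorbed as one more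
power and nothing has to be cancelled. -/
theorem eventuallyPeriodic_addInv (hn : 0 < n) (h : EventuallyPeriodic (phiMatrix n) i) {s : Rˣ}
    (hs : s ^ (2 * (n + 1)) = 1) : EventuallyPeriodic (addInv s) i := by
  obtain ⟨k, hk⟩ := h.eigenvalue (ZMod.castHom dvd_rfl R) (phiMatrix_map_mulVec_addInv _ hs)
  have := hk ⟨0, hn⟩
  simp only [zero_add, pow_one, ← pow_succ] at this
  exact ⟨k + 1, by rw [this]; congr 1; omega⟩

/-- Here the first coordinate is not a power of the eigenvalue; the extra factor remains, to be
cancelled where it is nonzero or a unit. -/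
theorem exists_pow_addInv_add_addInv (hn : 0 < n) (h : EventuallyPeriodic (sigmaMatrix n) i)
    {s t : Rˣ} (hs : s ^ (2 * (n + 1)) = 1) (ht : t ^ (2 * (n + 1)) = 1) :
    ∃ k, (addInv s + addInv t) ^ k * (addInv s * addInv t) =
      (addInv s + addInv t) ^ (k + i) * (addInv s * addInv t) := by
  obtain ⟨k, hk⟩ := h.eigenvalue (ZMod.castHom dvd_rfl R) (sigmaMatrix_map_mulVec_addInv _ hs ht)
  have := hk ⟨⟨0, hn⟩, ⟨0, hn⟩⟩
  simp only [zero_add, pow_one] at this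
  exact ⟨k, this⟩

end Eigenvectors

-- Faithful eigenvectors over group algebras.

universe u

/-- In the group algebra of the cyclic group of order `2(n + 1)`, the exponents `±1, …, ±n` are
pairwise distinct, so the entries have disjoint supports. -/
theorem exists_addInv_linearIndependent (R : Type u) [CommRing R] [CharP R 2] (n : ℕ) :
    ∃ (S : Type u) (_ : CommRing S) (_ : Algebra R S) (_ : CharP S 2) (s : Sˣ),
      s ^ (2 * (n + 1)) = 1 ∧ ∀ c : Fin n → R,
        ∑ a, algebraMap R S (c a) * addInv (s ^ (a + 1 : ℕ)) = 0 → c = 0 := by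
  let G := Multiplicative (ZMod (2 * (n + 1)))
  let φ : G →* (MonoidAlgebra R G)ˣ :=
    (Units.map (MonoidAlgebra.of R G)).comp (toUnits : G ≃* Gˣ).toMonoidHom
  let γ : G := Multiplicative.ofAdd 1
  have hinj : Function.Injective (algebraMap R (MonoidAlgebra R G)) := by
    intro x y h
    simpa using h
  have hpow : ∀ j : ℕ, γ ^ j = Multiplicative.ofAdd (j : ZMod (2 * (n + 1))) := fun j => by
    rw [← ofAdd_nsmul, nsmul_one]
  refine ⟨MonoidAlgebra R G, inferInstance, inferInstance,
    charP_of_injective_algebraMap hinj 2, φ γ, ?_, fun c hc => ?_⟩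
  · rw [← map_pow, hpow, ZMod.natCast_self, ofAdd_zero, map_one]
  · ext b
    have key : ∀ a : Fin n, (algebraMap R (MonoidAlgebra R G) (c a) *
        addInv (φ γ ^ (a + 1 : ℕ))).coeff (γ ^ (b + 1 : ℕ)) = if a = b then c a else 0 := by
      intro a
      rw [← map_pow, addInv, ← map_inv]
      have h1 : ((φ (γ ^ (a + 1 : ℕ)) : (MonoidAlgebra R G)ˣ) : MonoidAlgebra R G) =
        MonoidAlgebra.single (γ ^ (a + 1 : ℕ)) 1 := rfl
      have h2 : ((φ (γ ^ (a + 1 : ℕ))⁻¹ : (MonoidAlgebra R G)ˣ) : MonoidAlgebra R G) =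
        MonoidAlgebra.single (γ ^ (a + 1 : ℕ))⁻¹ 1 := rfl
      have h3 : (γ ^ (a + 1 : ℕ) = γ ^ (b + 1 : ℕ)) ↔ a = b := by
        rw [hpow, hpow, Multiplicative.ofAdd.injective.eq_iff, ZMod.natCast_eq_natCast_iff,
          Nat.ModEq, Nat.mod_eq_of_lt (by omega), Nat.mod_eq_of_lt (by omega), Fin.ext_iff]
        omega
      have h4 : ¬ (γ ^ (a + 1 : ℕ))⁻¹ = γ ^ (b + 1 : ℕ) := by
        rw [inv_eq_iff_mul_eq_one, ← pow_add, hpow, ← ofAdd_zero,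
          Multiplicative.ofAdd.injective.eq_iff, ZMod.natCast_eq_zero_iff]
        intro h
        have := Nat.le_of_dvd (by omega) h
        omega
      rw [h1, h2]
      simp [mul_add, MonoidAlgebra.coeff_single, Finsupp.single_apply, h3, h4]
    have := congrArg (fun x => x.coeff (γ ^ (b + 1 : ℕ))) hc
    simp only [MonoidAlgebra.coeff_sum, Finsupp.finsetSum_apply, key] at this
    simpa using this

/-- Each row of `X ^ k - X ^ (k + i)` is a relation over `GF(2)` among the entries of `v`, hence
zero. -/
theorem pow_eq_pow_of_mulVec {R : Type*} [CommRing R] {ι : Type*} [Fintype ι] [DecidableEq ι]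
    (f : ZMod 2 →+* R) {X : Matrix ι ι (ZMod 2)} {v : ι → R} {c : R} (h : X.map f *ᵥ v = c • v)
    (hv : ∀ x : ι → ZMod 2, ∑ a, f (x a) * v a = 0 → x = 0) {i : ℕ}
    (hc : EventuallyPeriodic c i) : EventuallyPeriodic X i := by
  obtain ⟨k, hk⟩ := hc
  refine ⟨k, ?_⟩
  have h1 : (X ^ k).map f *ᵥ v = (X ^ (k + i)).map f *ᵥ v := by
    rw [pow_map_mulVec f h, pow_map_mulVec f h, hk]
  ext a b
  have h2 := hv (fun b => (X ^ k) a b - (X ^ (k + i)) a b) (by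
    simp only [map_sub, sub_mul, Finset.sum_sub_distrib, sub_eq_zero]
    exact congrFun h1 a)
  exact sub_eq_zero.1 (congrFun h2 b)

theorem eventuallyPeriodic_phiMatrix_of (K : Type u) [Field K] [CharP K 2] {n i : ℕ}
    (h : ∀ (S : Type u) [CommRing S] [Algebra K S] [CharP S 2] (s : Sˣ),
      s ^ (2 * (n + 1)) = 1 → EventuallyPeriodic (addInv s) i) :
    EventuallyPeriodic (phiMatrix n) i := by
  obtain ⟨S, _, _, _, s, hs, hS⟩ := exists_addInv_linearIndependent K n
  refine pow_eq_pow_of_mulVec ((algebraMap K S).comp (ZMod.castHom dvd_rfl K))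
    (phiMatrix_map_mulVec_addInv _ hs) (fun x hx => ?_) (h S s hs)
  ext a
  exact (map_eq_zero (ZMod.castHom dvd_rfl K)).1 (congrFun (hS _ hx) a)

theorem eventuallyPeriodic_sigmaMatrix_of {n i : ℕ}
    (h : ∀ (S : Type) [CommRing S] [CharP S 2] (s t : Sˣ), s ^ (2 * (n + 1)) = 1 →
      t ^ (2 * (n + 1)) = 1 → EventuallyPeriodic (addInv s + addInv t) i) :
    EventuallyPeriodic (sigmaMatrix n) i := by
  obtain ⟨S, _, _, _, s, hs, hS⟩ := exists_addInv_linearIndependent (ZMod 2) n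
  -- Building `T` over `S` makes the products of entries independent over `GF(2)`.
  obtain ⟨T, _, _, _, t, ht, hT⟩ := exists_addInv_linearIndependent S n
  let s' : Tˣ := Units.map (algebraMap S T) s
  have hs' : s' ^ (2 * (n + 1)) = 1 := by rw [← map_pow, hs, map_one]
  have hss : ∀ j : ℕ, addInv (s' ^ j) = algebraMap S T (addInv (s ^ j)) := fun j => by
    rw [← map_pow, addInv, addInv, map_add, ← map_inv]
    rfl
  refine pow_eq_pow_of_mulVec ((algebraMap S T).comp (algebraMap (ZMod 2) S))
    (sigmaMatrix_map_mulVec_addInv _ hs' ht) (fun x hx => ?_) (h T s' t hs' ht)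
  have h1 := hT (fun b => ∑ a, algebraMap (ZMod 2) S (x (a, b)) * addInv (s ^ (a + 1 : ℕ))) (by
    rw [← hx, Fintype.sum_prod_type_right]
    refine Finset.sum_congr rfl fun b _ => ?_
    rw [map_sum, Finset.sum_mul]
    refine Finset.sum_congr rfl fun a _ => ?_
    rw [hss, map_mul, mul_assoc]
    rfl)
  ext ⟨a, b⟩
  exact congrFun (hS (fun a => x (a, b)) (congrFun h1 b)) a

/-! ### The nilpotent case, the passage from `Φ` to `σ`, and odd `n`. -/

theorem addInv_pow_eq_zero {R : Type*} [CommRing R] [CharP R 2] {k : ℕ} {s : Rˣ}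
    (hs : s ^ 2 ^ k = 1) : addInv s ^ 2 ^ k = 0 := by
  rw [addInv_pow, hs, addInv_eq_zero (one_pow 2)]

/-- If `n + 1` is a power of two then both automata are nilpotent. -/
theorem eventuallyPeriodic_of_eq_two_pow {n k : ℕ} (hn : n + 1 = 2 ^ k) (i : ℕ) :
    EventuallyPeriodic (phiMatrix n) i ∧ EventuallyPeriodic (sigmaMatrix n) i := by
  have h2 : 2 * (n + 1) = 2 ^ (k + 1) := by rw [hn, pow_succ']
  constructor
  · refine eventuallyPeriodic_phiMatrix_of (ZMod 2) fun S _ _ _ s hs => ?_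
    rw [h2] at hs
    exact .of_pow_eq_zero (addInv_pow_eq_zero hs) i
  · refine eventuallyPeriodic_sigmaMatrix_of fun S _ _ s t hs ht => ?_
    rw [h2] at hs ht
    have : ExpChar S 2 := ExpChar.prime Nat.prime_two
    refine .of_pow_eq_zero (q := 2 ^ (k + 1)) ?_ i
    rw [add_pow_expChar_pow, addInv_pow_eq_zero hs, addInv_pow_eq_zero ht, add_zero]

theorem eventuallyPeriodic_sigmaMatrix_of_dvd {n k m i : ℕ} (hn0 : 0 < n) (hn : n + 1 = 2 ^ k * m)
    (hm : Odd m) (hi : 2 ^ (k + 1) ∣ i) (h : EventuallyPeriodic (phiMatrix n) i) :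
    EventuallyPeriodic (sigmaMatrix n) i := by
  obtain ⟨j, rfl⟩ := hi
  obtain ⟨l, rfl⟩ := hm
  refine eventuallyPeriodic_sigmaMatrix_of fun S _ _ s t hs ht => .of_pow ?_
  have : ExpChar S 2 := ExpChar.prime Nat.prime_two
  have hN : 2 * (n + 1) = 2 ^ (k + 1) * (2 * l + 1) := by rw [hn]; ring
  have ha : ((s * t) ^ (l + 1)) ^ (2 * (n + 1)) = 1 := by
    rw [pow_right_comm, mul_pow, hs, ht, one_mul, one_pow]
  have hb : ((s * t⁻¹) ^ (l + 1)) ^ (2 * (n + 1)) = 1 := by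
    rw [pow_right_comm, mul_pow, inv_pow, hs, ht, inv_one, one_mul, one_pow]
  -- With `m = 2l + 1`, the exponent `l + 1` is one half modulo `m`: it supplies square roots of
  -- `st` and `s/t` up to factors killed by the `2^(k+1)`-th power.
  have key : (addInv s + addInv t) ^ 2 ^ (k + 1) =
      (addInv ((s * t) ^ (l + 1)) * addInv ((s * t⁻¹) ^ (l + 1))) ^ 2 ^ (k + 1) := by
    have e : ∀ u : Sˣ, u ^ (2 * (n + 1)) = 1 → (u ^ (2 * (l + 1))) ^ 2 ^ (k + 1) =
        u ^ 2 ^ (k + 1) := fun u hu => by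
      rw [← pow_mul, show 2 * (l + 1) * 2 ^ (k + 1) = 2 * (n + 1) + 2 ^ (k + 1) by rw [hN]; ring,
        pow_add, hu, one_mul]
    have e1 : (s * t) ^ (l + 1) * (s * t⁻¹) ^ (l + 1) = s ^ (2 * (l + 1)) := by
      rw [← mul_pow, mul_mul_mul_comm, mul_inv_cancel, mul_one, ← sq, pow_mul]
    have e2 : (s * t) ^ (l + 1) * ((s * t⁻¹) ^ (l + 1))⁻¹ = t ^ (2 * (l + 1)) := by
      rw [← inv_pow, ← mul_pow, mul_inv, inv_inv, mul_mul_mul_comm, mul_inv_cancel, one_mul, ← sq,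
        pow_mul]
    rw [addInv_mul, e1, e2, add_pow_expChar_pow, add_pow_expChar_pow, addInv_pow, addInv_pow,
      addInv_pow, addInv_pow, e s hs, e t ht]
  rw [key]
  exact .pow (by positivity)
    ((eventuallyPeriodic_addInv hn0 h ha).mul (eventuallyPeriodic_addInv hn0 h hb))

/-- The vector `(1, 0, 1, …, 0, 1)` lies in the kernel of `A_n`, so on `x ⊗ g` the matrix `T_n` acts
as `A_n` on `x`. -/
theorem eventuallyPeriodic_phiMatrix_of_odd {n i : ℕ} (hn : Odd n)
    (h : EventuallyPeriodic (sigmaMatrix n) i) : EventuallyPeriodic (phiMatrix n) i := by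
  obtain ⟨k, hk⟩ := h
  obtain ⟨l, rfl⟩ := hn
  let g : ℕ → ZMod 2 := fun j => j
  have hg : (phiMatrix (2 * l + 1)).map (RingHom.id (ZMod 2)) *ᵥ (fun a => g (a + 1)) = 0 := by
    have : g (2 * l + 1 + 1) = 0 := (ZMod.natCast_eq_zero_iff _ _).2 ⟨l + 1, by ring⟩
    rw [phiMatrix_map_mulVec _ (by simp [g]) this]
    ext a
    simp only [g, Nat.cast_add, Pi.zero_apply, ← add_assoc, CharTwo.add_self_eq_zero]
    exact (zero_add _).trans CharTwo.two_eq_zero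
  have key : ∀ (j : ℕ) (x : Fin (2 * l + 1) → ZMod 2),
      (sigmaMatrix (2 * l + 1)) ^ j *ᵥ (fun p => x p.1 * g (p.2 + 1)) =
        fun p => ((phiMatrix (2 * l + 1)) ^ j *ᵥ x) p.1 * g (p.2 + 1) := by
    intro j
    induction j with
    | zero => simp
    | succ j ih =>
      intro x
      have := sigmaMatrix_map_mulVec (RingHom.id (ZMod 2)) x (fun a => g (a + 1))
      rw [hg] at this
      simp only [RingHom.coe_id, Matrix.map_id, Pi.zero_apply, mul_zero, add_zero] at this
      rw [pow_succ, ← Matrix.mulVec_mulVec, this, ih, pow_succ, ← Matrix.mulVec_mulVec]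
  refine ⟨k, Matrix.ext_of_mulVec_single fun b => ?_⟩
  ext a
  have h1 := key k (Pi.single b 1)
  rw [hk, key] at h1
  -- The first entry of the kernel vector is 1, so column 0 of the grid recovers `A_n`.
  simpa [g] using (congrFun h1 (a, ⟨0, by omega⟩)).symm

/-! ### Nilpotent perturbations and the power of 2 in the periods of `Φ`. -/

open Polynomial

/-- In `K[X]/(X^(2^(e+1)))` the element `r ^ 2 ^ e` is a nonzero infinitesimal of square zero. -/
theorem exists_truncated_root (K : Type u) [Field K] [CharP K 2] (e : ℕ) :
    ∃ (S : Type u) (_ : CommRing S) (_ : Algebra K S) (_ : CharP S 2) (r : S),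
      r ^ 2 ^ (e + 1) = 0 ∧
        ∀ a b : K, algebraMap K S a + algebraMap K S b * r ^ 2 ^ e = 0 → b = 0 := by
  have hm : (X ^ 2 ^ (e + 1) : K[X]).Monic := monic_X_pow _
  have : Nontrivial (AdjoinRoot (X ^ 2 ^ (e + 1) : K[X])) :=
    AdjoinRoot.nontrivial _ (by simp)
  refine ⟨AdjoinRoot (X ^ 2 ^ (e + 1) : K[X]), inferInstance, inferInstance,
    charP_of_injective_algebraMap (algebraMap K _).injective 2, AdjoinRoot.root _, ?_, ?_⟩
  · rw [← AdjoinRoot.mk_X, ← map_pow, AdjoinRoot.mk_self]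
  · intro a b h
    rw [AdjoinRoot.algebraMap_eq, ← AdjoinRoot.mk_X, ← AdjoinRoot.mk_C, ← AdjoinRoot.mk_C,
      ← map_pow, ← map_mul, ← map_add, AdjoinRoot.mk_eq_zero, X_pow_dvd_iff] at h
    have := h (2 ^ e) (Nat.pow_lt_pow_right (by norm_num) (Nat.lt_succ_self e))
    have h0 : 2 ^ e ≠ 0 := by positivity
    simpa [coeff_C, h0] using this

section Infinitesimal

variable {K S : Type*} [Field K] [CommRing S] [Algebra K S] [CharP S 2] {δ : S}

theorem isUnit_add_mul_of_sq_eq_zero (hδ : δ ^ 2 = 0) {c : K} (d : K) (hc : c ≠ 0) :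
    IsUnit (algebraMap K S c + algebraMap K S d * δ) := by
  refine isUnit_of_mul_isUnit_left (y := algebraMap K S c + algebraMap K S d * δ) ?_
  rw [← sq, CharTwo.add_sq, mul_pow, hδ, mul_zero, add_zero]
  exact ((IsUnit.mk0 c hc).map (algebraMap K S)).pow 2

/-- Since `(c + dδ)² = c²`, an odd power of this unit keeps a nonzero `δ`-coefficient and cannot be
1. -/
theorem not_eventuallyPeriodic_add_mul (hδ : δ ^ 2 = 0)
    (hind : ∀ a b : K, algebraMap K S a + algebraMap K S b * δ = 0 → b = 0) {c d : K} (hc : c ≠ 0)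
    (hd : d ≠ 0) {j : ℕ} (hj : Odd j) :
    ¬ EventuallyPeriodic (algebraMap K S c + algebraMap K S d * δ) j := by
  intro h
  obtain ⟨l, rfl⟩ := hj
  have h1 := h.pow_eq_one (isUnit_add_mul_of_sq_eq_zero hδ d hc)
  rw [pow_succ, pow_mul, CharTwo.add_sq, mul_pow, hδ, mul_zero, add_zero] at h1
  have h2 := hind ((c ^ 2) ^ l * c - 1) ((c ^ 2) ^ l * d) (by
    simp only [map_sub, map_mul, map_pow, map_one]
    linear_combination h1)
  exact (mul_ne_zero (pow_ne_zero _ (pow_ne_zero _ hc)) hd) h2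

end Infinitesimal

/-- If `i = 2^e j` with `j` odd and `e ≤ k`, take `s = ζ(1 + r)` with `ζ` of order `m`. The `2^e`-th
power of its eigenvalue is `c(1 + δ)` with `c ≠ 0` and `δ = r^(2^e)`, which has no odd period. -/
theorem two_pow_dvd_of_eventuallyPeriodic {n k m i : ℕ} (hn0 : 0 < n) (hn : n + 1 = 2 ^ k * m)
    (hm : Odd m) (hm1 : m ≠ 1) (h : EventuallyPeriodic (phiMatrix n) i) : 2 ^ (k + 1) ∣ i := by
  by_contra hi
  have hi0 : i ≠ 0 := by rintro rfl; exact hi (dvd_zero _)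
  obtain ⟨e, j, hj, rfl⟩ := Nat.exists_eq_two_pow_mul_odd hi0
  have he : e ≤ k := by
    by_contra hlt
    exact hi ((pow_dvd_pow 2 (by omega)).mul_right j)
  let K := AlgebraicClosure (ZMod 2)
  have : NeZero m := ⟨by rintro rfl; simp at hm⟩
  have : NeZero (m : ZMod 2) := ⟨by rw [Ne, ZMod.natCast_eq_zero_iff]; exact hm.not_two_dvd_nat⟩
  obtain ⟨ζ₀, hζ₀⟩ := HasEnoughRootsOfUnity.exists_primitiveRoot K m
  obtain ⟨ζ, rfl⟩ := hζ₀.isUnit (NeZero.ne m)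
  have hζ : IsPrimitiveRoot ζ m := IsPrimitiveRoot.coe_units_iff.1 hζ₀
  obtain ⟨S, _, _, _, r, hr, hind⟩ := exists_truncated_root K e
  have : ExpChar S 2 := ExpChar.prime Nat.prime_two
  have h1r : (1 + r) ^ 2 ^ (e + 1) = 1 := by
    rw [add_pow_expChar_pow, one_pow, hr, add_zero]
  let u : Sˣ := Units.ofPowEqOne (1 + r) _ h1r (by positivity)
  have hu : u ^ 2 ^ (e + 1) = 1 := Units.pow_ofPowEqOne h1r (by positivity)
  have huv : ((u ^ 2 ^ e : Sˣ) : S) = 1 + r ^ 2 ^ e := by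
    rw [Units.val_pow_eq_pow_val]
    change (1 + r) ^ 2 ^ e = _
    rw [add_pow_expChar_pow, one_pow]
  let s : Sˣ := Units.map (algebraMap K S) ζ * u
  have hs : s ^ (2 * (n + 1)) = 1 := by
    have h1 : 2 * (n + 1) = m * 2 ^ (k + 1) := by rw [hn]; ring
    have h2 : 2 * (n + 1) = 2 ^ (e + 1) * (2 ^ (k - e) * m) := by
      obtain ⟨d, rfl⟩ := Nat.exists_eq_add_of_le he
      rw [hn, Nat.add_sub_cancel_left]
      ring
    rw [mul_pow, ← map_pow]
    nth_rw 1 [h1]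
    rw [h2, pow_mul, hζ.pow_eq_one, pow_mul u, hu]
    simp
  have hP := eventuallyPeriodic_addInv hn0 h hs
  have hP := hP.pow (q := 2 ^ e) (by positivity)
  have hw : addInv s ^ 2 ^ e = algebraMap K S (addInv (ζ ^ 2 ^ e)) +
      algebraMap K S (addInv (ζ ^ 2 ^ e)) * r ^ 2 ^ e := by
    have hinv : (u ^ 2 ^ e)⁻¹ = u ^ 2 ^ e := by
      rw [inv_eq_iff_mul_eq_one, ← sq, ← pow_mul, ← pow_succ, hu]
    rw [addInv_pow, addInv, addInv, mul_pow, mul_inv, hinv, Units.val_mul, Units.val_mul, huv,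
      ← map_pow, ← map_inv, map_add]
    change algebraMap K S _ * _ + algebraMap K S _ * _ = _
    ring
  have hne : addInv (ζ ^ 2 ^ e) ≠ 0 := by
    refine addInv_ne_zero hm (by rw [← pow_mul, mul_comm, pow_mul, hζ.pow_eq_one, one_pow]) ?_
    intro h1
    have h3 := (hζ.dvd_of_pow_eq_one _ h1)
    have h4 : Nat.Coprime m (2 ^ e) := (Nat.Coprime.pow_left e (Nat.coprime_two_left.2 hm)).symm
    exact hm1 (by simpa [Nat.Coprime, Nat.gcd_eq_left h3] using h4)
  rw [hw] at hP
  refine not_eventuallyPeriodic_add_mul ?_ hind hne hne hj hP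
  rw [← pow_mul, ← pow_succ, hr]

/-! ### From `σ` to `Φ` for even `n`. -/

section OddOrder

variable {n i : ℕ}

/-- Taking `s = ab` and `t = a/b` turns the eigenvalue of `T_n` into a product; the four conditions
make it and the extra factor nonzero. -/
theorem addInv_mul_pow_eq_one (hn : Even n) (hn0 : 0 < n) (h : EventuallyPeriodic (sigmaMatrix n) i)
    {K : Type*} [Field K] [CharP K 2] {a b : Kˣ} (ha : a ^ (n + 1) = 1) (hb : b ^ (n + 1) = 1)
    (ha1 : a ≠ 1) (hb1 : b ≠ 1) (hab : a * b ≠ 1) (hab' : a ≠ b) :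
    (addInv a * addInv b) ^ i = 1 := by
  have hm : Odd (n + 1) := hn.add_one
  have h1 : (a * b) ^ (n + 1) = 1 := by rw [mul_pow, ha, hb, one_mul]
  have h2 : (a * b⁻¹) ^ (n + 1) = 1 := by rw [mul_pow, inv_pow, ha, hb, inv_one, one_mul]
  obtain ⟨k, hk⟩ := exists_pow_addInv_add_addInv hn0 h
    (s := a * b) (t := a * b⁻¹) (by rw [pow_mul', h1, one_pow]) (by rw [pow_mul', h2, one_pow])
  rw [← addInv_mul, pow_add, mul_comm _ (_ * _), mul_comm _ (_ * _), ← mul_assoc] at hk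
  have hne : addInv (a * b) * addInv (a * b⁻¹) * (addInv a * addInv b) ^ k ≠ 0 :=
    mul_ne_zero (mul_ne_zero (addInv_ne_zero hm h1 hab)
      (addInv_ne_zero hm h2 fun h => hab' (mul_inv_eq_one.1 h)))
      (pow_ne_zero _ (mul_ne_zero (addInv_ne_zero hm ha ha1) (addInv_ne_zero hm hb hb1)))
  exact mul_left_cancel₀ hne (by rw [mul_one]; exact hk.symm)

theorem exists_isPrimitiveRoot_units (hn : Even n) :
    ∃ ζ : (AlgebraicClosure (ZMod 2))ˣ, IsPrimitiveRoot ζ (n + 1) := by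
  have : NeZero ((n + 1 : ℕ) : ZMod 2) :=
    ⟨by rw [Ne, ZMod.natCast_eq_zero_iff]; exact hn.add_one.not_two_dvd_nat⟩
  obtain ⟨ζ₀, hζ₀⟩ := HasEnoughRootsOfUnity.exists_primitiveRoot (AlgebraicClosure (ZMod 2)) (n + 1)
  obtain ⟨ζ, rfl⟩ := hζ₀.isUnit (NeZero.ne _)
  exact ⟨ζ, IsPrimitiveRoot.coe_units_iff.1 hζ₀⟩

theorem addInv_pow_eq_one (hn : Even n) (hn6 : 6 ≤ n) (h : EventuallyPeriodic (sigmaMatrix n) i)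
    {z : (AlgebraicClosure (ZMod 2))ˣ} (hz : z ^ (n + 1) = 1) (hz1 : z ≠ 1) :
    addInv z ^ i = 1 := by
  classical
  obtain ⟨ζ, hζ⟩ := exists_isPrimitiveRoot_units hn
  let U : Finset (AlgebraicClosure (ZMod 2))ˣ := (Finset.range (n + 1)).image (ζ ^ ·)
  have hU : U.card = n + 1 := by
    rw [Finset.card_image_of_injOn, Finset.card_range]
    intro a ha b hb hab
    exact hζ.pow_inj (Finset.mem_range.1 ha) (Finset.mem_range.1 hb) hab
  have hUpow : ∀ x ∈ U, x ^ (n + 1) = 1 := by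
    intro x hx
    obtain ⟨j, -, rfl⟩ := Finset.mem_image.1 hx
    rw [pow_right_comm, hζ.pow_eq_one, one_pow]
  have pick : ∀ F : Finset (AlgebraicClosure (ZMod 2))ˣ, F.card ≤ 5 → ∃ x ∈ U, x ∉ F := by
    intro F hF
    exact Finset.exists_mem_notMem_of_card_lt_card (by omega)
  obtain ⟨b, hbU, hb⟩ := pick {1, z, z⁻¹} (Finset.card_le_three.trans (by norm_num))
  -- Avoiding five elements requires at least six roots of unity; this is where `n = 4` fails.
  obtain ⟨c, hcU, hc⟩ := pick {1, z, z⁻¹, b, b⁻¹} Finset.card_le_five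
  simp only [Finset.mem_insert, Finset.mem_singleton, not_or] at hb hc
  have hne : ∀ {x y : (AlgebraicClosure (ZMod 2))ˣ}, y ≠ x⁻¹ → x * y ≠ 1 :=
    fun h h' => h (eq_inv_of_mul_eq_one_right h')
  have hzb := addInv_mul_pow_eq_one hn (by omega) h hz (hUpow b hbU) hz1 hb.1 (hne hb.2.2)
    (Ne.symm hb.2.1)
  have hzc := addInv_mul_pow_eq_one hn (by omega) h hz (hUpow c hcU) hz1 hc.1 (hne hc.2.2.1)
    (Ne.symm hc.2.1)
  have hbc := addInv_mul_pow_eq_one hn (by omega) h (hUpow b hbU) (hUpow c hcU) hb.1 hc.1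
    (hne hc.2.2.2.2) (Ne.symm hc.2.2.2.1)
  rw [mul_pow] at hzb hzc hbc
  -- The products for the pairs `zb`, `zc` and `bc` are all 1, which isolates the square of the
  -- `z`-factor.
  have hsq : (addInv z ^ i) ^ 2 = 1 := by
    calc (addInv z ^ i) ^ 2 = (addInv z ^ i) ^ 2 * (addInv b ^ i * addInv c ^ i) := by
          rw [hbc, mul_one]
      _ = (addInv z ^ i * addInv b ^ i) * (addInv z ^ i * addInv c ^ i) := by ring
      _ = 1 := by rw [hzb, hzc, one_mul]
  exact CharTwo.sq_injective (hsq.trans (one_pow 2).symm)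

/-- Perturbing `s = η³` infinitesimally and keeping `t = η` gives an eigenvalue with constant term
`w(η³) + w(η) = w(η²) w(η) ≠ 0` and nonzero infinitesimal part, so an odd period is impossible. -/
theorem even_of_eventuallyPeriodic_sigmaMatrix (hn : Even n) (hn6 : 6 ≤ n)
    (h : EventuallyPeriodic (sigmaMatrix n) i) : Even i := by
  by_contra hi
  rw [Nat.not_even_iff_odd] at hi
  have hm : Odd (n + 1) := hn.add_one
  let K := AlgebraicClosure (ZMod 2)
  obtain ⟨η, hη⟩ := exists_isPrimitiveRoot_units hn
  have hne : ∀ j, 0 < j → j < n + 1 → addInv (η ^ j) ≠ 0 := fun j h0 hj =>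
    addInv_ne_zero hm (by rw [pow_right_comm, hη.pow_eq_one, one_pow])
      (hη.pow_ne_one_of_pos_of_lt h0.ne' hj)
  obtain ⟨S, _, _, _, r, hr, hind⟩ := exists_truncated_root K 0
  simp only [zero_add, pow_one, pow_zero] at hr hind
  have h1r : (1 + r) ^ 2 = 1 := by
    rw [CharTwo.add_sq, one_pow, hr, add_zero]
  let u : Sˣ := Units.ofPowEqOne (1 + r) _ h1r (by positivity)
  have hu : u ^ 2 = 1 := Units.pow_ofPowEqOne h1r (by positivity)
  have huinv : u⁻¹ = u := by rw [inv_eq_iff_mul_eq_one, ← sq, hu]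
  have huv : (u : S) = 1 + r := rfl
  let φ := Units.map (algebraMap K S : K →* S)
  have hη3 : (η ^ 3) ^ (n + 1) = 1 := by rw [pow_right_comm, hη.pow_eq_one, one_pow]
  obtain ⟨k, hk⟩ := exists_pow_addInv_add_addInv (by omega) h (s := φ (η ^ 3) * u) (t := φ η)
    (by rw [mul_pow, ← map_pow, pow_mul', hη3, pow_mul u, hu]; simp)
    (by rw [← map_pow, pow_mul', hη.pow_eq_one]; simp)
  have hs : addInv (φ (η ^ 3) * u) =
      algebraMap K S (addInv (η ^ 3)) + algebraMap K S (addInv (η ^ 3)) * r := by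
    rw [addInv, addInv, mul_inv, huinv, Units.val_mul, Units.val_mul, huv, ← map_inv, map_add]
    change algebraMap K S _ * _ + algebraMap K S _ * _ = _
    ring
  have ht : addInv (φ η) = algebraMap K S (addInv η) := by
    rw [addInv, addInv, ← map_inv, map_add]
    rfl
  have hsu : IsUnit (addInv (φ (η ^ 3) * u)) := by
    rw [hs]
    exact isUnit_add_mul_of_sq_eq_zero hr _ (hne 3 (by omega) (by omega))
  have htu : IsUnit (addInv (φ η)) := by
    rw [ht]
    have := hne 1 (by omega) (by omega)
    rw [pow_one] at this
    exact (IsUnit.mk0 _ this).map (algebraMap K S)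
  have hP : EventuallyPeriodic (addInv (φ (η ^ 3) * u) + addInv (φ η)) i :=
    ⟨k, (hsu.mul htu).mul_right_cancel hk⟩
  rw [hs, ht, add_right_comm, ← map_add] at hP
  have hprod := addInv_mul (η ^ 2) η
  rw [pow_succ η 1, mul_inv_cancel_right, pow_one, ← sq, ← pow_succ] at hprod
  have hsum : addInv (η ^ 3) + addInv η ≠ 0 := by
    rw [← hprod]
    have := hne 1 (by omega) (by omega)
    rw [pow_one] at this
    exact mul_ne_zero (hne 2 (by omega) (by omega)) this
  exact not_eventuallyPeriodic_add_mul hr hind hsum (hne 3 (by omega) (by omega)) hi hP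

theorem eventuallyPeriodic_phiMatrix_of_even (hn : Even n) (hn6 : 6 ≤ n)
    (h : EventuallyPeriodic (sigmaMatrix n) i) : EventuallyPeriodic (phiMatrix n) i := by
  obtain ⟨j, rfl⟩ := even_iff_two_dvd.1 (even_of_eventuallyPeriodic_sigmaMatrix hn hn6 h)
  let K := AlgebraicClosure (ZMod 2)
  obtain ⟨ζ, hζ⟩ := exists_isPrimitiveRoot_units hn
  have hζ' : IsPrimitiveRoot (ζ : K) (n + 1) := IsPrimitiveRoot.coe_units_iff.2 hζ
  -- As `z² + 1 = z w(z)`, the last factor vanishes at `z` when `w(z)^j = 1`; the factor `X² + 1`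
  -- takes care of `z = 1`.
  have hdvd : (X ^ (n + 1) - 1 : K[X]) ∣ (X ^ 2 + 1) * ((X ^ 2 + 1) ^ j + X ^ j) := by
    rw [X_pow_sub_one_eq_prod (Nat.succ_pos n) hζ']
    refine Finset.prod_dvd_of_coprime
      (fun a _ b _ hab => isCoprime_X_sub_C_of_isUnit_sub (sub_ne_zero.2 hab).isUnit)
      fun z hz => ?_
    rw [mem_nthRootsFinset (Nat.succ_pos n)] at hz
    obtain ⟨z, rfl⟩ := (IsUnit.of_pow_eq_one hz (Nat.succ_ne_zero n))
    rw [dvd_iff_isRoot, IsRoot.def]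
    simp only [eval_mul, eval_add, eval_pow, eval_X, eval_one]
    have hz' : z ^ (n + 1) = 1 := by ext; simpa using hz
    have hw : (z : K) ^ 2 + 1 = z * addInv z := by
      rw [addInv, mul_add, Units.mul_inv, sq]
    by_cases hz1 : z = 1
    · simp [hz1, CharTwo.add_self_eq_zero]
    · have h1 := addInv_pow_eq_one hn hn6 h hz' hz1
      have h2 : addInv z ^ j = 1 := by
        rw [mul_comm, pow_mul] at h1
        exact CharTwo.sq_injective (h1.trans (one_pow 2).symm)
      rw [hw, mul_pow, h2, mul_one, CharTwo.add_self_eq_zero, mul_zero]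
  refine eventuallyPeriodic_phiMatrix_of K fun S _ _ _ s hs => ?_
  obtain ⟨p, hp⟩ := hdvd
  -- Squaring passes from `X^(n+1) - 1` to `X^(2(n+1)) - 1`, which the generic `s` satisfies, and
  -- doubles the period `j` to `2j`.
  have hp' := congrArg (fun f => (aeval (s : S) f) ^ 2) hp
  have hs2 : ((s : S) ^ (n + 1) - 1) ^ 2 = 0 := by
    rw [CharTwo.sub_eq_add, CharTwo.add_sq, ← pow_mul, mul_comm, ← Units.val_pow_eq_pow_val, hs,
      one_pow, Units.val_one, CharTwo.add_self_eq_zero]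
  have hw : (s : S) ^ 2 + 1 = s * addInv s := by
    rw [addInv, mul_add, Units.mul_inv, sq]
  simp only [map_mul, map_add, map_pow, map_sub, aeval_X, map_one, mul_pow, hs2, zero_mul, hw]
    at hp'
  have key : (s : S) ^ (2 * (j + 1)) * (addInv s ^ 2 * (addInv s ^ j + 1) ^ 2) = 0 := by
    rw [← hp']
    ring
  have key2 : addInv s ^ 2 * (addInv s ^ j + 1) ^ 2 = 0 :=
    (s.isUnit.pow _).mul_left_cancel (by rw [key, mul_zero])
  rw [CharTwo.add_sq, mul_add, one_pow, mul_one, CharTwo.add_eq_zero, ← pow_mul, ← pow_add] at key2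
  exact ⟨2, by rw [← key2, mul_comm j]⟩

end OddOrder

/-! ### Equality of the periods. -/

theorem eventuallyPeriodic_iff {n : ℕ} (hn2 : n ≠ 2) (hn4 : n ≠ 4) (i : ℕ) :
    EventuallyPeriodic (phiMatrix n) i ↔ EventuallyPeriodic (sigmaMatrix n) i := by
  obtain ⟨k, m, hm, hkm⟩ := Nat.exists_eq_two_pow_mul_odd (Nat.succ_ne_zero n)
  by_cases hm1 : m = 1
  · rw [hm1, mul_one] at hkm
    have := eventuallyPeriodic_of_eq_two_pow hkm i
    exact ⟨fun _ => this.2, fun _ => this.1⟩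
  have hn0 : 0 < n := by
    rcases Nat.eq_zero_or_pos n with rfl | h
    · exact absurd (Nat.eq_one_of_mul_eq_one_left hkm.symm) hm1
    · exact h
  refine ⟨fun h => eventuallyPeriodic_sigmaMatrix_of_dvd hn0 hkm hm
    (two_pow_dvd_of_eventuallyPeriodic hn0 hkm hm hm1 h) h, fun h => ?_⟩
  rcases Nat.even_or_odd n with hn | hn
  · refine eventuallyPeriodic_phiMatrix_of_even hn ?_ h
    obtain ⟨l, rfl⟩ := hn
    omega
  · exact eventuallyPeriodic_phiMatrix_of_odd hn h

/-! ### The exceptional grids `n = 2` and `n = 4`. -/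

theorem cycleLength_eq_of_isUnit {ι : Type*} [Fintype ι] [DecidableEq ι]
    {X : Matrix ι ι (ZMod 2)} {p : ℕ} (hp : 0 < p) (h : X ^ p = 1)
    (hmin : ∀ i, 0 < i → i < p → X ^ i ≠ 1) : cycleLength X = p := by
  refine (isLeast_cycleLength X).unique ⟨⟨hp, 0, by rw [zero_add, h, pow_zero]⟩, ?_⟩
  rintro i ⟨hi, hX⟩
  by_contra hlt
  exact hmin i hi (not_le.1 hlt)
    (EventuallyPeriodic.pow_eq_one (IsUnit.of_pow_eq_one h hp.ne') hX)

theorem cycleLength_phiMatrix_two : cycleLength (phiMatrix 2) = 2 := by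
  refine cycleLength_eq_of_isUnit (by norm_num) (by decide) fun i h0 h2 => ?_
  interval_cases i
  decide

theorem phiMatrix_four_sq :
    phiMatrix 4 ^ 2 = !![1, 0, 1, 0; 0, 0, 0, 1; 1, 0, 0, 0; 0, 1, 0, 1] := by
  decide

theorem cycleLength_phiMatrix_four : cycleLength (phiMatrix 4) = 6 := by
  have h2 := phiMatrix_four_sq
  have h3 : phiMatrix 4 ^ 3 = !![0, 0, 0, 1; 0, 0, 1, 0; 0, 1, 0, 0; 1, 0, 0, 0] := by
    rw [pow_succ, h2]; decide
  have h6 : phiMatrix 4 ^ 6 = 1 := by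
    rw [show 6 = 3 * 2 by rfl, pow_mul, h3]; decide
  refine cycleLength_eq_of_isUnit (by norm_num) h6 fun i h0 hi => ?_
  interval_cases i
  · decide
  · rw [h2]; decide
  · rw [h3]; decide
  · intro h
    have : phiMatrix 4 ^ 2 = 1 := by rw [← h6, pow_add _ 4 2, h, one_mul]
    rw [h2] at this
    exact absurd this (by decide)
  · intro h
    have : phiMatrix 4 ^ 1 = 1 := by rw [← h6, pow_add _ 5 1, h, one_mul]
    exact absurd this (by decide)

theorem cycleLength_sigmaMatrix_two : cycleLength (sigmaMatrix 2) = 1 := by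
  have h : sigmaMatrix 2 ^ 2 = 0 := by decide
  refine (isLeast_cycleLength _).unique ⟨⟨one_pos, 2, by rw [pow_add, h, zero_mul]⟩, ?_⟩
  rintro i ⟨hi, -⟩
  exact hi

theorem kroneckerSum_sq {ι : Type*} [Fintype ι] [DecidableEq ι] (M : Matrix ι ι (ZMod 2)) :
    kroneckerSum M M ^ 2 = kroneckerSum (M ^ 2) (M ^ 2) := by
  have h : M ⊗ₖ M + M ⊗ₖ M = 0 := by
    ext
    exact CharTwo.add_self_eq_zero _
  simp only [kroneckerSum, sq, add_mul, mul_add, ← Matrix.mul_kronecker_mul, mul_one, one_mul]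
  rw [add_assoc, ← add_assoc (M ⊗ₖ M), h, zero_add]

theorem kroneckerSum_add_one {ι : Type*} [Fintype ι] [DecidableEq ι] (M : Matrix ι ι (ZMod 2)) :
    kroneckerSum (M + 1) (M + 1) = kroneckerSum M M := by
  ext p q
  simp only [kroneckerSum, Matrix.add_kronecker, Matrix.kronecker_add, Matrix.add_apply]
  linear_combination CharTwo.add_self_eq_zero (((1 : Matrix ι ι (ZMod 2)) ⊗ₖ 1) p q)

/-- With `B = A_4²` one has `B² = B + 1`, and the Kronecker sum does not see the added identity. -/
theorem sigmaMatrix_four_sq : sigmaMatrix 4 ^ 2 = sigmaMatrix 4 ^ (2 + 2) := by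
  have h : (phiMatrix 4 ^ 2) ^ 2 = phiMatrix 4 ^ 2 + 1 := by
    rw [phiMatrix_four_sq]
    decide
  rw [pow_mul (sigmaMatrix 4) 2 2, sigmaMatrix, kroneckerSum_sq, kroneckerSum_sq, h,
    kroneckerSum_add_one]

theorem sigmaMatrix_four_sq_ne : sigmaMatrix 4 ^ 2 ≠ sigmaMatrix 4 ^ 3 := by
  intro h
  rw [pow_succ _ 2, sigmaMatrix, kroneckerSum_sq, phiMatrix_four_sq] at h
  have := congrFun (congrFun h (0, 0)) (0, 2)
  revert this
  decide

theorem cycleLength_sigmaMatrix_four : cycleLength (sigmaMatrix 4) = 2 := by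
  refine (isLeast_cycleLength _).unique ⟨⟨two_pos, 2, sigmaMatrix_four_sq⟩, ?_⟩
  rintro i ⟨hi, k, hk⟩
  by_contra hlt
  obtain rfl : i = 1 := by omega
  have h : ∀ l, sigmaMatrix 4 ^ (2 + 2 * l) = sigmaMatrix 4 ^ 2 := by
    intro l
    induction l with
    | zero => rfl
    | succ l ih => rw [← ih, EventuallyPeriodic.shift sigmaMatrix_four_sq (2 * l)]; rfl
  -- The shift by `k + 2` brings the exponent to `2 + 2k`, where period 2 reduces a period 1 to `T²
  -- = T³`.
  have h1 := EventuallyPeriodic.shift hk (k + 2)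
  rw [show k + (k + 2) = 2 + 2 * k by ring, pow_add _ (2 + 2 * k) 1, h, ← pow_add] at h1
  exact sigmaMatrix_four_sq_ne h1

end LightsOut

theorem mainTheorem1 :
    (∀ n : ℕ, n ≠ 2 → n ≠ 4 →
      LightsOut.cycleLength (LightsOut.phiMatrix n) =
        LightsOut.cycleLength (LightsOut.sigmaMatrix n)) ∧
    LightsOut.cycleLength (LightsOut.phiMatrix 2) = 2 ∧
    LightsOut.cycleLength (LightsOut.sigmaMatrix 2) = 1 ∧
    LightsOut.cycleLength (LightsOut.phiMatrix 4) = 6 ∧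
    LightsOut.cycleLength (LightsOut.sigmaMatrix 4) = 2 :=
  ⟨fun _ h2 h4 => LightsOut.cycleLength_congr (LightsOut.eventuallyPeriodic_iff h2 h4),
    LightsOut.cycleLength_phiMatrix_two, LightsOut.cycleLength_sigmaMatrix_two,
    LightsOut.cycleLength_phiMatrix_four, LightsOut.cycleLength_sigmaMatrix_four⟩
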